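/- Let $\|\cdot\|$ be the Frobenius norm, and for a matrix $A\in\mathbb{R}^{p\times q}$ let $\sigma_1(A)\ge\sigma_2(A)\ge\dots$ be its singular values, $\sigma_{\max}(A)=\sigma_1(A)$, $\sigma_{\min}(A)=\sigma_{\min\{p,q\}}(A)$, and $\sigma_*(A)$ the smallest nonzero singular value. Let $X_{\rm trn}\in\mathbb{R}^{N\times m}$, $X_{\rm val}\in\mathbb{R}^{N'\times m}$ have full row rank (with $m\ge\max\{N,N'\}$), let $Y_{\rm trn}\in\mathbb{R}^{N\times n}$, $Y_{\rm val}\in\mathbb{R}^{N'\times n}$, let $h\ge\max\{m,n\}$, and for $W_1\in\mathbb{R}^{m\times h}$, $W_2\in\mathbb{R}^{h\times n}$ put $$L_{\rm trn}(W_1,W_2)=\tfrac12\|Y_{\rm trn}-X_{\rm trn}W_1W_2\|^2,\quad L_{\rm val}(W_1,W_2)=\tfrac12\|Y_{\rm val}-X_{\rm val}W_1W_2\|^2,\quad L^*_{\rm trn}(W_1)=\min_{W_2}L_{\rm trn}(W_1,W_2),$$ $$L_\gamma(W_1,W_2)=L_{\rm val}(W_1,W_2)+\gamma\,(L_{\rm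 trn}(W_1,W_2)-L^*_{\rm trn}(W_1)),\qquad \gamma>0,\qquad L_\gamma^*=\min_{W_1,W_2}L_\gamma(W_1,W_2).$$ Call $(W_1^*,W_2^*)$ an $(\epsilon_1,\epsilon_2)$ solution of the bilevel problem if $L_{\rm trn}(W_1^*,W_2^*)-L^*_{\rm trn}(W_1^*)\le\epsilon_2$ and $L_{\rm val}(W_1^*,W_2^*)\le L_{\rm val}(W_1,W_2)+\epsilon_1$ for all $(W_1,W_2)$ with $L_{\rm trn}(W_1,W_2)-L^*_{\rm trn}(W_1)\le\epsilon_2$. Assume that for all $\epsilon_1,\epsilon_2\ge 0$ there is an $(\epsilon_1,\epsilon_2)$ solution $(W_1^*,W_2^*)$ with $L_{\rm trn}(W_1^*,W_2^*)-\min_{W_1,W_2}L_{\rm trn}(W_1,W_2)\le\epsilon_2$. Let $(W_1^k,W_2^k,W_3^k)_{k\ge0}$ be generated from any initial point by penalty-based bilevel gradient descent in Jacobi fashion with step sizes $\alpha>0$ and $\beta$ and inner iteration numbers $T_k$: $W_3^{k+1}$ is the result of $T_k$ steps $W\mapsto W-\beta\nabla_{W_2}L_{\rm trn}(W_1^k,W)$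 started at $W_3^0$, and $$W_1^{k+1}=W_1^k-\alpha\big(\nabla_{W_1}L_{\rm val}(W_1^k,W_2^k)+\gamma(\nabla_{W_1}L_{\rm trn}(W_1^k,W_2^k)-\nabla_{W_1}L_{\rm trn}(W_1^k,W_3^{k+1}))\big),$$ $$W_2^{k+1}=W_2^k-\alpha\big(\nabla_{W_2}L_{\rm val}(W_1^k,W_2^k)+\gamma\nabla_{W_2}L_{\rm trn}(W_1^k,W_2^k)\big).$$ Let $X_\gamma=[X_{\rm val};\sqrt\gamma X_{\rm trn}]$, and let $k$ be such that $\sigma_{\min}^2(W_1^k)>0$ and $\sigma_{\min}^2(W_2^k)>0$. Then the minimum $L_\gamma^*$ is attained, $L_\gamma$ is differentiable at $(W_1^k,W_2^k)$, $L^*_{\rm trn}$ is differentiable at $W_1^k$, and with $\mu_k=(\sigma_{\min}^2(W_1^k)+\sigma_{\min}^2(W_2^k))\,\sigma_*^2(X_\gamma)$ the joint PL inequality $$\|\nabla L_\gamma(W_1^k,W_2^k)\|^2\ge 2\mu_k\,(L_\gamma(W_1^k,W_2^k)-L_\gamma^*)$$ holds. Moreover, with $\delta_k=\gamma\,(\nabla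 L^*_{\rm trn}(W_1^k)-\nabla_{W_1}L_{\rm trn}(W_1^k,W_3^{k+1}))$, $\Delta_k=L_\gamma(W_1^k,W_2^k)-L_\gamma^*$, $s=\sigma_{\max}(X_\gamma)$ and $$\begin{aligned}L_k={}&s^2(\sigma_{\max}^2(W_1^k)+\sigma_{\max}^2(W_2^k))+3\alpha\|\delta_k\|s^2\sigma_{\max}(W_2^k)+\big(1+3\alpha s^2(\sigma_{\max}^2(W_1^k)+\sigma_{\max}^2(W_2^k))\big)\sqrt{2s^2\Delta_k}\\&+3\alpha^2s^2\|\delta_k\|\sigma_{\max}(W_1^k)\sqrt{2s^2\Delta_k}+6\alpha^2s^4\sigma_{\max}(W_1^kW_2^k)\Delta_k,\end{aligned}$$ the descent inequality holds: $$L_\gamma(W_1^{k+1},W_2^{k+1})\le L_\gamma(W_1^k,W_2^k)-\Big(\frac\alpha2-\alpha^2L_k\Big)\|\nabla L_\gamma(W_1^k,W_2^k)\|^2+\Big(\frac\alpha2+\alpha^2L_k\Big)\|\delta_k\|^2.$$ -/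

import Mathlib

open scoped Matrix

attribute [local instance] Matrix.frobeniusNormedAddCommGroup Matrix.frobeniusNormedSpace

noncomputable section

namespace BilevelRep

/-- The singular values of a real matrix in descending order, indexed from `0`
(so the `i`-th singular value in the usual numbering is `sv A (i - 1)`). -/
def sv {p q : Type*} [Fintype p] [Fintype q] [DecidableEq q] (A : Matrix p q ℝ) (i : ℕ) : ℝ :=
  (Matrix.toEuclideanLin A).singularValues i

/-- The largest singular value. -/
def sigmaMax {p q : Type*} [Fintype p] [Fintype q] [DecidableEq q] (A : Matrix p q ℝ) : ℝ :=
  sv A 0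

/-- The smallest singular value, the one with number `min p q` for a `p × q` matrix
(and `0` for a matrix without rows or without columns). -/
def sigmaMin {p q : Type*} [Fintype p] [Fintype q] [DecidableEq q] (A : Matrix p q ℝ) : ℝ :=
  if min (Fintype.card p) (Fintype.card q) = 0 then 0
  else sv A (min (Fintype.card p) (Fintype.card q) - 1)

/-- The smallest nonzero singular value (and `0` for the zero matrix). -/
def sigmaStar {p q : Type*} [Fintype p] [Fintype q] [DecidableEq q] (A : Matrix p q ℝ) : ℝ :=
  sInf {s : ℝ | 0 < s ∧ ∃ i, sv A i = s}

/-- The gradient of a real function of a matrix with respect to the Frobenius inner product: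
the matrix of its partial derivatives. -/
def matGrad {p q : Type*} [Fintype p] [Fintype q] [DecidableEq p] [DecidableEq q]
    (f : Matrix p q ℝ → ℝ) (W : Matrix p q ℝ) : Matrix p q ℝ :=
  Matrix.of fun i j => lineDeriv ℝ f W (Matrix.single i j 1)

/-- Training data (`N` samples) and validation data (`N'` samples) with features in `ℝ^m` and
labels in `ℝ^n`; samples and labels are the rows. -/
structure Data (N N' m n : ℕ) where
  Xtrn : Matrix (Fin N) (Fin m) ℝ
  Ytrn : Matrix (Fin N) (Fin n) ℝ
  Xval : Matrix (Fin N') (Fin m) ℝ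
  Yval : Matrix (Fin N') (Fin n) ℝ

namespace Data

variable {N N' m n h : ℕ} (D : Data N N' m n)

/-- Training loss of the two-layer linear network. -/
def Ltrn (W₁ : Matrix (Fin m) (Fin h) ℝ) (W₂ : Matrix (Fin h) (Fin n) ℝ) : ℝ :=
  1 / 2 * ‖D.Ytrn - D.Xtrn * W₁ * W₂‖ ^ 2

/-- Validation loss of the two-layer linear network. -/
def Lval (W₁ : Matrix (Fin m) (Fin h) ℝ) (W₂ : Matrix (Fin h) (Fin n) ℝ) : ℝ :=
  1 / 2 * ‖D.Yval - D.Xval * W₁ * W₂‖ ^ 2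

/-- The lower-level value function `min_{W₂} Ltrn(W₁, W₂)`. -/
def LtrnStar (W₁ : Matrix (Fin m) (Fin h) ℝ) : ℝ :=
  ⨅ W₂ : Matrix (Fin h) (Fin n) ℝ, D.Ltrn W₁ W₂

/-- The penalized objective. -/
def Lpen (γ : ℝ) (W₁ : Matrix (Fin m) (Fin h) ℝ) (W₂ : Matrix (Fin h) (Fin n) ℝ) : ℝ :=
  D.Lval W₁ W₂ + γ * (D.Ltrn W₁ W₂ - D.LtrnStar W₁)

/-- The optimal value of the penalized objective for hidden width `h`. -/
def LpenStar (h : ℕ) (γ : ℝ) : ℝ :=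
  ⨅ W : Matrix (Fin m) (Fin h) ℝ × Matrix (Fin h) (Fin n) ℝ, D.Lpen γ W.1 W.2

/-- The squared norm of the gradient of the penalized objective in both blocks. -/
def normSqGradLpen (γ : ℝ) (W₁ : Matrix (Fin m) (Fin h) ℝ) (W₂ : Matrix (Fin h) (Fin n) ℝ) : ℝ :=
  ‖matGrad (fun V => D.Lpen γ V W₂) W₁‖ ^ 2 + ‖matGrad (fun V => D.Lpen γ W₁ V) W₂‖ ^ 2

/-- `(W₁, W₂)` is an `(ε₁, ε₂)` global solution of the bilevel problem with upper-level
objective `Lval` and lower-level objective `Ltrn`. -/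
def IsSolution (ε₁ ε₂ : ℝ) (W₁ : Matrix (Fin m) (Fin h) ℝ) (W₂ : Matrix (Fin h) (Fin n) ℝ) :
    Prop :=
  D.Ltrn W₁ W₂ - D.LtrnStar W₁ ≤ ε₂ ∧
    ∀ (V₁ : Matrix (Fin m) (Fin h) ℝ) (V₂ : Matrix (Fin h) (Fin n) ℝ),
      D.Ltrn V₁ V₂ - D.LtrnStar V₁ ≤ ε₂ → D.Lval W₁ W₂ ≤ D.Lval V₁ V₂ + ε₁

/-- For all `ε₁, ε₂ ≥ 0` some `(ε₁, ε₂)` solution of the bilevel problem of hidden width `h` is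
`ε₂`-optimal for the training loss jointly in both layers. -/
def Compatible (h : ℕ) : Prop :=
  ∀ ε₁ ε₂ : ℝ, 0 ≤ ε₁ → 0 ≤ ε₂ →
    ∃ (W₁ : Matrix (Fin m) (Fin h) ℝ) (W₂ : Matrix (Fin h) (Fin n) ℝ),
      D.IsSolution ε₁ ε₂ W₁ W₂ ∧
        D.Ltrn W₁ W₂ -
          (⨅ V : Matrix (Fin m) (Fin h) ℝ × Matrix (Fin h) (Fin n) ℝ, D.Ltrn V.1 V.2) ≤ ε₂

/-- The concatenated data matrix `[X_val; √γ X_trn]`. -/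
def Xpen (γ : ℝ) : Matrix (Fin N' ⊕ Fin N) (Fin m) ℝ :=
  Matrix.fromRows D.Xval (√γ • D.Xtrn)

/-- One inner step: gradient descent with step size `β` on the lower-level objective. -/
def innerStep (β : ℝ) (W₁ : Matrix (Fin m) (Fin h) ℝ) (W : Matrix (Fin h) (Fin n) ℝ) :
    Matrix (Fin h) (Fin n) ℝ :=
  W - β • matGrad (fun V => D.Ltrn W₁ V) W

/-- The sequences `W₁, W₂, W₃` are generated by penalty-based bilevel gradient descent in the
Jacobi fashion, with outer step size `α`, inner step size `β` and `T k` inner steps at outer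
iteration `k`, every inner loop being initialized at `W₃ 0`. -/
def IsPBGD (γ α β : ℝ) (T : ℕ → ℕ) (W₁ : ℕ → Matrix (Fin m) (Fin h) ℝ)
    (W₂ W₃ : ℕ → Matrix (Fin h) (Fin n) ℝ) : Prop :=
  ∀ k : ℕ,
    W₃ (k + 1) = (D.innerStep β (W₁ k))^[T k] (W₃ 0) ∧
    W₁ (k + 1) = W₁ k - α • (matGrad (fun V => D.Lval V (W₂ k)) (W₁ k) +
      γ • (matGrad (fun V => D.Ltrn V (W₂ k)) (W₁ k) -
        matGrad (fun V => D.Ltrn V (W₃ (k + 1))) (W₁ k))) ∧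
    W₂ (k + 1) = W₂ k - α • (matGrad (fun V => D.Lval (W₁ k) V) (W₂ k) +
      γ • matGrad (fun V => D.Ltrn (W₁ k) V) (W₂ k))

/-- The error made in the gradient of the penalized objective at `W₁` when the gradient of the
value function is estimated by the partial gradient of the training loss at `(W₁, W₃)`. -/
def gradBias (γ : ℝ) (W₁ : Matrix (Fin m) (Fin h) ℝ) (W₃ : Matrix (Fin h) (Fin n) ℝ) :
    Matrix (Fin m) (Fin h) ℝ :=
  γ • (matGrad (fun V => D.LtrnStar V) W₁ - matGrad (fun V => D.Ltrn V W₃) W₁)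

/-- The local joint PL constant at `(W₁, W₂)`. -/
def plConst (γ : ℝ) (W₁ : Matrix (Fin m) (Fin h) ℝ) (W₂ : Matrix (Fin h) (Fin n) ℝ) : ℝ :=
  (sigmaMin W₁ ^ 2 + sigmaMin W₂ ^ 2) * sigmaStar (D.Xpen γ) ^ 2

/-- The local smoothness constant at `(W₁, W₂)` for the step size `α` and the bias `δ`. -/
def smoothConst (γ α δ : ℝ) (W₁ : Matrix (Fin m) (Fin h) ℝ)
    (W₂ : Matrix (Fin h) (Fin n) ℝ) : ℝ :=
  sigmaMax (D.Xpen γ) ^ 2 * (sigmaMax W₁ ^ 2 + sigmaMax W₂ ^ 2)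
    + 3 * α * δ * sigmaMax (D.Xpen γ) ^ 2 * sigmaMax W₂
    + (1 + 3 * α * sigmaMax (D.Xpen γ) ^ 2 * (sigmaMax W₁ ^ 2 + sigmaMax W₂ ^ 2))
      * √(2 * sigmaMax (D.Xpen γ) ^ 2 * (D.Lpen γ W₁ W₂ - D.LpenStar h γ))
    + 3 * α ^ 2 * sigmaMax (D.Xpen γ) ^ 2 * δ * sigmaMax W₁
      * √(2 * sigmaMax (D.Xpen γ) ^ 2 * (D.Lpen γ W₁ W₂ - D.LpenStar h γ))
    + 6 * α ^ 2 * sigmaMax (D.Xpen γ) ^ 4 * sigmaMax (W₁ * W₂)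
      * (D.Lpen γ W₁ W₂ - D.LpenStar h γ)

end Data

end BilevelRep

end

/-! If `W₁ C = 1`, then every weight matrix is of the form `W₁ W₂`, and the same holds for all
matrices near `W₁`. Hence the value function `LtrnStar` is constant near `W₁`, its gradient vanishes
there, and up to this constant the penalized objective is the least-squares loss of the stacked data
`Xpen`, `Ypen` at `W₁ W₂`. Compatibility bounds the penalized objective from below by the minimum
of that loss also where the value function is larger.

The gradient `G` of a least-squares loss at `W` is `Xᵀ X (W - W₀)` for a minimizer `W₀`, so
`‖G‖²` lies between `2 σ_*(X)²` and `2 σ_max(X)²` times the suboptimality; the PL inequality follows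
since the partial gradients are `G W₂ᵀ` and `W₁ᵀ G`. The loss is quadratic, so its change in a step
is exactly the inner product of `G` with the increment of `W₁ W₂` plus a square, and the descent
inequality follows from bounds on the first- and second-order parts of that increment. -/

namespace BilevelRep

open Matrix Module Filter Topology

section SingularValues

variable {𝕜 E F : Type*} [RCLike 𝕜] [NormedAddCommGroup E] [InnerProductSpace 𝕜 E]
  [FiniteDimensional 𝕜 E] [NormedAddCommGroup F] [InnerProductSpace 𝕜 F] [FiniteDimensional 𝕜 F]
  (T : E →ₗ[𝕜] F)

/-- An orthonormal basis of right singular vectors of `T`, the `i`-th one belonging to the `i`-th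
singular value: the eigenvector basis of `T† T`. -/
noncomputable def rightSingularBasis : OrthonormalBasis (Fin (finrank 𝕜 E)) 𝕜 E :=
  T.isSymmetric_adjoint_comp_self.eigenvectorBasis rfl

theorem inner_rightSingularBasis_adjoint_apply (v : E) (i : Fin (finrank 𝕜 E)) :
    inner 𝕜 (rightSingularBasis T i) (T.adjoint (T v)) =
      ((T.singularValues i ^ 2 : ℝ) : 𝕜) * inner 𝕜 (rightSingularBasis T i) v := by
  have h := T.isSymmetric_adjoint_comp_self.eigenvectorBasis_apply_self_apply rfl v i
  rwa [OrthonormalBasis.repr_apply_apply, OrthonormalBasis.repr_apply_apply,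
    ← T.sq_singularValues_fin rfl i] at h

theorem norm_sq_apply_eq_sum_singularValues (v : E) :
    ‖T v‖ ^ 2 =
      ∑ i : Fin (finrank 𝕜 E),
        T.singularValues i ^ 2 * ‖inner 𝕜 (rightSingularBasis T i) v‖ ^ 2 := by
  rw [← inner_self_eq_norm_sq (𝕜 := 𝕜), ← T.adjoint_inner_right,
    ← (rightSingularBasis T).sum_inner_mul_inner, map_sum]
  refine Finset.sum_congr rfl fun i _ => ?_
  rw [inner_rightSingularBasis_adjoint_apply, mul_left_comm, RCLike.re_ofReal_mul,
    inner_mul_symm_re_eq_norm, norm_mul, norm_inner_symm, sq ‖_‖]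

theorem norm_sq_adjoint_apply_apply_eq_sum_singularValues (v : E) :
    ‖T.adjoint (T v)‖ ^ 2 =
      ∑ i : Fin (finrank 𝕜 E),
        T.singularValues i ^ 4 * ‖inner 𝕜 (rightSingularBasis T i) v‖ ^ 2 := by
  rw [← (rightSingularBasis T).sum_sq_norm_inner_right]
  refine Finset.sum_congr rfl fun i _ => ?_
  rw [inner_rightSingularBasis_adjoint_apply, norm_mul, mul_pow, RCLike.norm_ofReal, sq_abs,
    ← pow_mul]

theorem norm_apply_le_singularValues_zero_mul (v : E) :
    ‖T v‖ ≤ T.singularValues 0 * ‖v‖ := by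
  refine le_of_sq_le_sq ?_ (mul_nonneg (T.singularValues_nonneg 0) (norm_nonneg v))
  rw [norm_sq_apply_eq_sum_singularValues, mul_pow,
    ← (rightSingularBasis T).sum_sq_norm_inner_right, Finset.mul_sum]
  gcongr with i
  · exact T.singularValues_nonneg _
  · exact T.singularValues_antitone (Nat.zero_le _)

theorem mul_norm_le_norm_apply {s : ℝ} (hs : 0 ≤ s)
    (h : ∀ i < finrank 𝕜 E, s ≤ T.singularValues i) (v : E) : s * ‖v‖ ≤ ‖T v‖ := by
  refine le_of_sq_le_sq ?_ (norm_nonneg _)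
  rw [norm_sq_apply_eq_sum_singularValues, mul_pow,
    ← (rightSingularBasis T).sum_sq_norm_inner_right, Finset.mul_sum]
  gcongr with i
  exact h i i.isLt

theorem mul_norm_apply_le_norm_adjoint_apply {s : ℝ} (hs : 0 ≤ s)
    (h : ∀ i, 0 < T.singularValues i → s ≤ T.singularValues i) (v : E) :
    s * ‖T v‖ ≤ ‖T.adjoint (T v)‖ := by
  refine le_of_sq_le_sq ?_ (norm_nonneg _)
  rw [norm_sq_adjoint_apply_apply_eq_sum_singularValues, mul_pow,
    norm_sq_apply_eq_sum_singularValues, Finset.mul_sum]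
  refine Finset.sum_le_sum fun i _ => ?_
  rw [← mul_assoc]
  gcongr
  rcases (T.singularValues_nonneg i).eq_or_lt with h_zero | h_pos
  · simp [← h_zero]
  · rw [show 4 = 2 + 2 from rfl, pow_add]
    gcongr
    exact h i h_pos

end SingularValues

section Frobenius

variable {p q r : Type*} [Fintype p] [Fintype q] [Fintype r]

theorem frobenius_norm_sq (A : Matrix p q ℝ) : ‖A‖ ^ 2 = ∑ i, ∑ j, A i j ^ 2 := by
  rw [frobenius_norm_def, ← Real.rpow_natCast, ← Real.rpow_mul (by positivity)]
  norm_num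

theorem frobenius_norm_sq_eq_trace (A : Matrix p q ℝ) : ‖A‖ ^ 2 = trace (Aᵀ * A) := by
  rw [frobenius_norm_sq, Finset.sum_comm]
  simp [trace, mul_apply, sq]

/-- The Frobenius inner product `⟪A, B⟫ = tr (Aᵀ B)`, which induces the Frobenius norm. It is
made an instance only locally, like the norm. -/
noncomputable abbrev frobeniusInnerProductSpace : InnerProductSpace ℝ (Matrix p q ℝ) where
  inner A B := trace (Aᵀ * B)
  norm_sq_eq_re_inner := frobenius_norm_sq_eq_trace
  conj_inner_symm A B := by
    rw [conj_trivial, ← trace_transpose, transpose_mul, transpose_transpose]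
  add_left A B C := by rw [transpose_add, Matrix.add_mul, trace_add]
  smul_left A B c := by rw [transpose_smul, Matrix.smul_mul, trace_smul, conj_trivial, smul_eq_mul]

attribute [local instance] frobeniusInnerProductSpace

theorem inner_eq_trace (A B : Matrix p q ℝ) : inner ℝ A B = trace (Aᵀ * B) :=
  rfl

theorem inner_mul_right_eq_inner_transpose_mul (A : Matrix p r ℝ) (B : Matrix p q ℝ)
    (C : Matrix q r ℝ) : inner ℝ A (B * C) = inner ℝ (Bᵀ * A) C := by
  simp only [inner_eq_trace, transpose_mul, transpose_transpose, Matrix.mul_assoc]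

theorem inner_mul_right_eq_inner_mul_transpose (A : Matrix p r ℝ) (B : Matrix p q ℝ)
    (C : Matrix q r ℝ) : inner ℝ A (B * C) = inner ℝ (A * Cᵀ) B := by
  rw [inner_eq_trace, inner_eq_trace, transpose_mul, transpose_transpose, ← Matrix.mul_assoc,
    trace_mul_comm, ← Matrix.mul_assoc]

theorem inner_single_right [DecidableEq p] [DecidableEq q] (A : Matrix p q ℝ) (i : p) (j : q) :
    inner ℝ A (single i j 1) = A i j := by
  rw [inner_eq_trace, trace_mul_comm, trace_single_mul, one_smul, transpose_apply]

theorem frobenius_norm_sq_eq_sum_col (A : Matrix p q ℝ) :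
    ‖A‖ ^ 2 = ∑ j, ‖WithLp.toLp 2 (A.col j)‖ ^ 2 := by
  rw [frobenius_norm_sq, Finset.sum_comm]
  simp [EuclideanSpace.norm_sq_eq]

theorem toLp_col_mul {m n : Type*} [DecidableEq q] (A : Matrix m q ℝ) (B : Matrix q n ℝ)
    (j : n) :
    WithLp.toLp 2 ((A * B).col j) = toEuclideanLin A (WithLp.toLp 2 (B.col j)) := by
  ext i
  simp [mul_apply, mulVec, dotProduct]

theorem adjoint_toEuclideanLin [DecidableEq p] [DecidableEq q] (A : Matrix p q ℝ) :
    (toEuclideanLin A).adjoint = toEuclideanLin Aᵀ := by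
  rw [← toEuclideanLin_conjTranspose_eq_adjoint, conjTranspose_eq_transpose_of_trivial]

theorem mul_frobenius_norm_le_of_col {c d : ℝ} (hc : 0 ≤ c) (hd : 0 ≤ d) {A : Matrix p r ℝ}
    {B : Matrix q r ℝ}
    (h : ∀ j, c * ‖WithLp.toLp 2 (A.col j)‖ ≤ d * ‖WithLp.toLp 2 (B.col j)‖) :
    c * ‖A‖ ≤ d * ‖B‖ := by
  refine le_of_sq_le_sq ?_ (by positivity)
  simp only [mul_pow, frobenius_norm_sq_eq_sum_col, Finset.mul_sum]
  refine Finset.sum_le_sum fun j _ => ?_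
  rw [← mul_pow, ← mul_pow]
  exact pow_le_pow_left₀ (by positivity) (h j) 2

theorem sv_nonneg [DecidableEq q] (A : Matrix p q ℝ) (i : ℕ) : 0 ≤ sv A i :=
  LinearMap.singularValues_nonneg _ _

theorem sigmaMax_nonneg [DecidableEq q] (A : Matrix p q ℝ) : 0 ≤ sigmaMax A :=
  sv_nonneg A 0

theorem norm_mul_le_sigmaMax_mul [DecidableEq q] (A : Matrix p q ℝ) (B : Matrix q r ℝ) :
    ‖A * B‖ ≤ sigmaMax A * ‖B‖ := by
  rw [← one_mul ‖A * B‖]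
  refine mul_frobenius_norm_le_of_col zero_le_one (sigmaMax_nonneg A) fun j => ?_
  rw [one_mul, toLp_col_mul]
  exact norm_apply_le_singularValues_zero_mul _ _

theorem norm_transpose_mul_le_sigmaMax_mul [DecidableEq q] (A : Matrix p q ℝ)
    (B : Matrix p r ℝ) : ‖Aᵀ * B‖ ≤ sigmaMax A * ‖B‖ := by
  rcases (norm_nonneg (Aᵀ * B)).eq_or_lt with h_zero | h_pos
  · rw [← h_zero]
    exact mul_nonneg (sigmaMax_nonneg A) (norm_nonneg B)
  · refine le_of_mul_le_mul_right ?_ h_pos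
    calc ‖Aᵀ * B‖ * ‖Aᵀ * B‖ = inner ℝ B (A * (Aᵀ * B)) := by
          rw [inner_mul_right_eq_inner_transpose_mul, real_inner_self_eq_norm_mul_norm]
      _ ≤ ‖B‖ * ‖A * (Aᵀ * B)‖ := real_inner_le_norm _ _
      _ ≤ ‖B‖ * (sigmaMax A * ‖Aᵀ * B‖) := by gcongr; exact norm_mul_le_sigmaMax_mul A _
      _ = sigmaMax A * ‖B‖ * ‖Aᵀ * B‖ := by ring

theorem norm_mul_le_sigmaMax_mul_right [DecidableEq q] (A : Matrix r p ℝ) (B : Matrix p q ℝ) :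
    ‖A * B‖ ≤ sigmaMax B * ‖A‖ := by
  rw [← frobenius_norm_transpose (A * B), ← frobenius_norm_transpose A, transpose_mul]
  exact norm_transpose_mul_le_sigmaMax_mul B Aᵀ

theorem sigmaMin_nonneg [DecidableEq q] (A : Matrix p q ℝ) : 0 ≤ sigmaMin A := by
  unfold sigmaMin
  split_ifs
  exacts [le_rfl, sv_nonneg _ _]

theorem sigmaMin_le_sv [DecidableEq q] (A : Matrix p q ℝ) {i : ℕ}
    (hi : i < min (Fintype.card p) (Fintype.card q)) : sigmaMin A ≤ sv A i := by
  rw [sigmaMin, if_neg (by lia)]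
  exact LinearMap.singularValues_antitone _ (by lia)

theorem sigmaStar_nonneg [DecidableEq q] (A : Matrix p q ℝ) : 0 ≤ sigmaStar A :=
  Real.sInf_nonneg fun _ hs => hs.1.le

theorem sigmaStar_le_sv [DecidableEq q] (A : Matrix p q ℝ) {i : ℕ} (hi : 0 < sv A i) :
    sigmaStar A ≤ sv A i :=
  csInf_le ⟨0, fun _ hs => hs.1.le⟩ ⟨hi, i, rfl⟩

theorem mul_norm_mul_le_norm_transpose_mul_mul [DecidableEq q] {A : Matrix p q ℝ} {s : ℝ}
    (hs : 0 ≤ s) (h : ∀ i, 0 < sv A i → s ≤ sv A i) (B : Matrix q r ℝ) :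
    s * ‖A * B‖ ≤ ‖Aᵀ * (A * B)‖ := by
  classical
  rw [← one_mul ‖Aᵀ * (A * B)‖]
  refine mul_frobenius_norm_le_of_col hs zero_le_one fun j => ?_
  rw [one_mul, toLp_col_mul Aᵀ, toLp_col_mul, ← adjoint_toEuclideanLin]
  exact mul_norm_apply_le_norm_adjoint_apply _ hs h _

theorem sigmaStar_mul_norm_mul_le [DecidableEq q] (A : Matrix p q ℝ) (B : Matrix q r ℝ) :
    sigmaStar A * ‖A * B‖ ≤ ‖Aᵀ * (A * B)‖ :=
  mul_norm_mul_le_norm_transpose_mul_mul (sigmaStar_nonneg A) (fun _ => sigmaStar_le_sv A) B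

theorem sigmaMin_mul_norm_le_norm_mul [DecidableEq q] {A : Matrix p q ℝ}
    (hqp : Fintype.card q ≤ Fintype.card p) (B : Matrix q r ℝ) :
    sigmaMin A * ‖B‖ ≤ ‖A * B‖ := by
  rw [← one_mul ‖A * B‖]
  refine mul_frobenius_norm_le_of_col (sigmaMin_nonneg A) zero_le_one fun j => ?_
  rw [one_mul, toLp_col_mul]
  refine mul_norm_le_norm_apply _ (sigmaMin_nonneg A) (fun i hi => ?_) _
  rw [finrank_euclideanSpace] at hi
  exact sigmaMin_le_sv A (lt_min (hi.trans_le hqp) hi)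

theorem sv_pos_iff_lt_rank [DecidableEq q] (A : Matrix p q ℝ) {i : ℕ} :
    0 < sv A i ↔ i < A.rank := by
  rw [A.rank_eq_finrank_range_toLin (EuclideanSpace.basisFun p ℝ).toBasis
    (EuclideanSpace.basisFun q ℝ).toBasis]
  exact LinearMap.singularValues_pos_iff_lt_finrank_range _

theorem rank_eq_card_of_sigmaMin_ne_zero [DecidableEq q] {A : Matrix p q ℝ}
    (hpq : Fintype.card p ≤ Fintype.card q) (hA : sigmaMin A ≠ 0) :
    A.rank = Fintype.card p := by
  have hA' := (sigmaMin_nonneg A).lt_of_ne' hA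
  rw [sigmaMin, min_eq_left hpq] at hA'
  split_ifs at hA' with h_card
  · exact absurd hA' (lt_irrefl 0)
  · have h_rank := (sv_pos_iff_lt_rank A).1 hA'
    exact (rank_le_card_height A).antisymm (by lia)

theorem exists_mul_eq_one_of_sigmaMin_ne_zero [DecidableEq p] [DecidableEq q]
    {A : Matrix p q ℝ} (hpq : Fintype.card p ≤ Fintype.card q) (hA : sigmaMin A ≠ 0) :
    ∃ C : Matrix q p ℝ, A * C = 1 := by
  have h_range : A.mulVecLin.range = ⊤ := Submodule.eq_top_of_finrank_eq <| by
    rw [Module.finrank_fintype_fun_eq_card]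
    exact rank_eq_card_of_sigmaMin_ne_zero hpq hA
  exact mulVec_surjective_iff_exists_right_inverse.1 (LinearMap.range_eq_top.1 h_range)

theorem sigmaMin_mul_norm_le_norm_transpose_mul [DecidableEq q] {A : Matrix p q ℝ}
    (hpq : Fintype.card p ≤ Fintype.card q) (B : Matrix p r ℝ) :
    sigmaMin A * ‖B‖ ≤ ‖Aᵀ * B‖ := by
  classical
  by_cases hA : sigmaMin A = 0
  · rw [hA, zero_mul]
    exact norm_nonneg _
  · obtain ⟨C, hC⟩ := exists_mul_eq_one_of_sigmaMin_ne_zero hpq hA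
    have hB : A * (C * B) = B := by rw [← Matrix.mul_assoc, hC, Matrix.one_mul]
    rw [← hB]
    refine mul_norm_mul_le_norm_transpose_mul_mul (sigmaMin_nonneg A) (fun i hi => ?_) (C * B)
    rw [sv_pos_iff_lt_rank, rank_eq_card_of_sigmaMin_ne_zero hpq hA] at hi
    exact sigmaMin_le_sv A (lt_min hi (hi.trans_le hpq))

theorem sigmaMin_mul_norm_le_norm_mul_transpose [DecidableEq q] {A : Matrix p q ℝ}
    (hqp : Fintype.card q ≤ Fintype.card p) (B : Matrix r q ℝ) :
    sigmaMin A * ‖B‖ ≤ ‖B * Aᵀ‖ := by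
  rw [← frobenius_norm_transpose B, ← frobenius_norm_transpose (B * Aᵀ), transpose_mul,
    transpose_transpose]
  exact sigmaMin_mul_norm_le_norm_mul hqp Bᵀ

theorem eventually_exists_mul_eq_one {n : Type*} [Finite n] [DecidableEq n] {A : Matrix n q ℝ}
    {C : Matrix q n ℝ} (hAC : A * C = 1) :
    ∀ᶠ V : Matrix n q ℝ in 𝓝 A, ∃ B : Matrix q n ℝ, V * B = 1 := by
  cases nonempty_fintype n
  have h_cont : Continuous fun V : Matrix n q ℝ => (V * C).det := by fun_prop
  have h_det : (A * C).det ≠ 0 := by rw [hAC, det_one]; exact one_ne_zero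
  filter_upwards [h_cont.continuousAt.eventually_ne h_det] with V hV
  exact ⟨C * (V * C)⁻¹, by
    rw [← Matrix.mul_assoc, mul_nonsing_inv _ (isUnit_iff_ne_zero.2 hV)]⟩

theorem matGrad_eq_of_hasLineDerivAt [DecidableEq p] [DecidableEq q] {f : Matrix p q ℝ → ℝ}
    {W G : Matrix p q ℝ} (h : ∀ E, HasLineDerivAt ℝ f (inner ℝ G E) W E) : matGrad f W = G := by
  ext i j
  rw [matGrad, of_apply, (h _).lineDeriv, inner_single_right]

theorem matGrad_congr [DecidableEq p] [DecidableEq q] {f g : Matrix p q ℝ → ℝ}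
    {W : Matrix p q ℝ} (h : f =ᶠ[𝓝 W] g) : matGrad f W = matGrad g W := by
  ext
  exact h.lineDeriv_eq

theorem matGrad_const [DecidableEq p] [DecidableEq q] (c : ℝ) (W : Matrix p q ℝ) :
    matGrad (fun _ => c) W = 0 := by
  ext
  exact deriv_const 0 c

theorem matGrad_sub_const [DecidableEq p] [DecidableEq q] (f : Matrix p q ℝ → ℝ) (c : ℝ)
    (W : Matrix p q ℝ) : matGrad (fun V => f V - c) W = matGrad f W := by
  ext
  exact deriv_sub_const c

/-- The least-squares loss `½ ‖Y - X W‖²` of the linear model with weights `W`; the losses of the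
two-layer network are its values at `W₁ W₂`. -/
noncomputable def lsLoss (X : Matrix p q ℝ) (Y : Matrix p r ℝ) (W : Matrix q r ℝ) : ℝ :=
  1 / 2 * ‖Y - X * W‖ ^ 2

/-- The gradient of the least-squares loss with respect to the Frobenius inner product. -/
def lsGrad (X : Matrix p q ℝ) (Y : Matrix p r ℝ) (W : Matrix q r ℝ) : Matrix q r ℝ :=
  Xᵀ * (X * W - Y)

/-- The minimum of the least-squares loss. -/
noncomputable def lsMin (X : Matrix p q ℝ) (Y : Matrix p r ℝ) : ℝ :=
  ⨅ W : Matrix q r ℝ, lsLoss X Y W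

section LeastSquares

variable {s : Type*} [Fintype s] (X : Matrix p q ℝ) (Y : Matrix p r ℝ)

theorem lsLoss_add (W E : Matrix q r ℝ) :
    lsLoss X Y (W + E) = lsLoss X Y W + inner ℝ (lsGrad X Y W) E + 1 / 2 * ‖X * E‖ ^ 2 := by
  have h_residual : X * (W + E) - Y = X * W - Y + X * E := by rw [Matrix.mul_add]; abel
  rw [lsLoss, lsLoss, norm_sub_rev, h_residual, norm_add_sq_real,
    inner_mul_right_eq_inner_transpose_mul, norm_sub_rev Y, ← lsGrad]
  ring

theorem hasLineDerivAt_lsLoss (W E : Matrix q r ℝ) :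
    HasLineDerivAt ℝ (lsLoss X Y) (inner ℝ (lsGrad X Y W) E) W E := by
  have h_line (t : ℝ) : lsLoss X Y (W + t • E) =
      lsLoss X Y W + t * inner ℝ (lsGrad X Y W) E + t ^ 2 * (1 / 2 * ‖X * E‖ ^ 2) := by
    rw [lsLoss_add, inner_smul_right_eq_smul, Matrix.mul_smul, norm_smul, mul_pow,
      Real.norm_eq_abs, sq_abs, smul_eq_mul]
    ring
  simp only [HasLineDerivAt, h_line]
  convert! (((hasDerivAt_id' (0 : ℝ)).mul_const (inner ℝ (lsGrad X Y W) E)).const_add _).add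
    ((hasDerivAt_pow 2 (0 : ℝ)).mul_const (1 / 2 * ‖X * E‖ ^ 2)) using 1
  simp

theorem matGrad_lsLoss_mul_left [DecidableEq q] [DecidableEq s] (a : Matrix q s ℝ)
    (b : Matrix s r ℝ) :
    matGrad (fun V => lsLoss X Y (V * b)) a = lsGrad X Y (a * b) * bᵀ := by
  refine matGrad_eq_of_hasLineDerivAt fun E => ?_
  rw [← inner_mul_right_eq_inner_mul_transpose]
  simpa only [HasLineDerivAt, Matrix.add_mul, Matrix.smul_mul] using
    hasLineDerivAt_lsLoss X Y (a * b) (E * b)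

theorem matGrad_lsLoss_mul_right [DecidableEq r] [DecidableEq s] (a : Matrix q s ℝ)
    (b : Matrix s r ℝ) :
    matGrad (fun V => lsLoss X Y (a * V)) b = aᵀ * lsGrad X Y (a * b) := by
  refine matGrad_eq_of_hasLineDerivAt fun E => ?_
  rw [← inner_mul_right_eq_inner_transpose_mul]
  simpa only [HasLineDerivAt, Matrix.mul_add, Matrix.mul_smul] using
    hasLineDerivAt_lsLoss X Y (a * b) (a * E)

theorem differentiable_lsLoss_mul : Differentiable ℝ
    fun W : Matrix q s ℝ × Matrix s r ℝ => lsLoss X Y (W.1 * W.2) := by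
  have h_mul : IsBoundedBilinearMap ℝ fun W : Matrix q s ℝ × Matrix s r ℝ => W.1 * W.2 :=
    { add_left := Matrix.add_mul
      smul_left := Matrix.smul_mul
      add_right := Matrix.mul_add
      smul_right := fun c A B => Matrix.mul_smul A c B
      bound := ⟨1, one_pos, fun A B => by rw [one_mul]; exact frobenius_norm_mul A B⟩ }
  have h_left : Differentiable ℝ fun W : Matrix q r ℝ => X * W :=
    (mulLeftLinearMap r ℝ X).toContinuousLinearMap.differentiable
  exact (((differentiable_const Y).sub
    (h_left.comp h_mul.differentiable)).norm_sq ℝ).const_mul _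

theorem adjoint_mulLeftLinearMap :
    (mulLeftLinearMap r ℝ X).adjoint = mulLeftLinearMap r ℝ Xᵀ := by
  refine ((LinearMap.eq_adjoint_iff _ _).2 fun A B => ?_).symm
  exact (inner_mul_right_eq_inner_transpose_mul A X B).symm

theorem exists_lsGrad_eq_zero {t : Type*} [Finite t] (Y : Matrix p t ℝ) :
    ∃ W : Matrix q t ℝ, lsGrad X Y W = 0 := by
  cases nonempty_fintype t
  have h_mem : Xᵀ * Y ∈ (mulLeftLinearMap t ℝ X).adjoint.range := ⟨Y, by
    rw [adjoint_mulLeftLinearMap]; rfl⟩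
  rw [← LinearMap.range_adjoint_comp_self, adjoint_mulLeftLinearMap] at h_mem
  obtain ⟨W, hW⟩ := h_mem
  exact ⟨W, (Matrix.mul_sub _ _ _).trans (sub_eq_zero.2 hW)⟩

variable {X Y}

theorem lsLoss_eq_of_lsGrad_eq_zero {W₀ : Matrix q r ℝ} (h : lsGrad X Y W₀ = 0)
    (W : Matrix q r ℝ) : lsLoss X Y W = lsLoss X Y W₀ + 1 / 2 * ‖X * (W - W₀)‖ ^ 2 := by
  rw [← add_sub_cancel W₀ W, lsLoss_add, h, inner_zero_left, add_zero, add_sub_cancel]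

theorem lsGrad_eq_of_lsGrad_eq_zero {t : Type*} {Y : Matrix p t ℝ} {W₀ : Matrix q t ℝ}
    (h : lsGrad X Y W₀ = 0) (W : Matrix q t ℝ) : lsGrad X Y W = Xᵀ * (X * (W - W₀)) := by
  rw [← sub_zero (lsGrad X Y W), ← h, lsGrad, lsGrad, ← Matrix.mul_sub, sub_sub_sub_cancel_right,
    ← Matrix.mul_sub]

theorem isLeast_lsLoss_of_lsGrad_eq_zero {W₀ : Matrix q r ℝ} (h : lsGrad X Y W₀ = 0) :
    IsLeast (Set.range fun W : Matrix q r ℝ => lsLoss X Y W) (lsLoss X Y W₀) := by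
  refine ⟨⟨W₀, rfl⟩, Set.forall_mem_range.2 fun W => ?_⟩
  rw [lsLoss_eq_of_lsGrad_eq_zero h W]
  exact le_add_of_nonneg_right (by positivity)

theorem lsMin_eq_of_lsGrad_eq_zero {W₀ : Matrix q r ℝ} (h : lsGrad X Y W₀ = 0) :
    lsMin X Y = lsLoss X Y W₀ :=
  (isLeast_lsLoss_of_lsGrad_eq_zero h).csInf_eq

variable (X Y)

theorem lsMin_le_lsLoss (W : Matrix q r ℝ) : lsMin X Y ≤ lsLoss X Y W :=
  ciInf_le ⟨0, by rintro _ ⟨V, rfl⟩; unfold lsLoss; positivity⟩ W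

theorem lsMin_eq_iInf_mul_left [DecidableEq q] {a : Matrix q s ℝ} {c : Matrix s q ℝ}
    (hac : a * c = 1) : ⨅ V : Matrix s r ℝ, lsLoss X Y (a * V) = lsMin X Y :=
  Function.Surjective.iInf_comp (f := fun V : Matrix s r ℝ => a * V)
    (fun W => ⟨c * W, by dsimp only; rw [← Matrix.mul_assoc, hac, Matrix.one_mul]⟩) (lsLoss X Y)

theorem norm_lsGrad_sq_le [DecidableEq q] (W : Matrix q r ℝ) :
    ‖lsGrad X Y W‖ ^ 2 ≤ 2 * sigmaMax X ^ 2 * (lsLoss X Y W - lsMin X Y) := by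
  obtain ⟨W₀, h⟩ := exists_lsGrad_eq_zero X Y
  rw [lsMin_eq_of_lsGrad_eq_zero h, lsGrad_eq_of_lsGrad_eq_zero h,
    lsLoss_eq_of_lsGrad_eq_zero h W]
  calc ‖Xᵀ * (X * (W - W₀))‖ ^ 2 ≤ (sigmaMax X * ‖X * (W - W₀)‖) ^ 2 := by
        gcongr
        exact norm_transpose_mul_le_sigmaMax_mul _ _
    _ = _ := by ring

theorem le_norm_lsGrad_sq [DecidableEq q] (W : Matrix q r ℝ) :
    2 * sigmaStar X ^ 2 * (lsLoss X Y W - lsMin X Y) ≤ ‖lsGrad X Y W‖ ^ 2 := by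
  obtain ⟨W₀, h⟩ := exists_lsGrad_eq_zero X Y
  rw [lsMin_eq_of_lsGrad_eq_zero h, lsGrad_eq_of_lsGrad_eq_zero h,
    lsLoss_eq_of_lsGrad_eq_zero h W]
  calc 2 * sigmaStar X ^ 2 * (lsLoss X Y W₀ + 1 / 2 * ‖X * (W - W₀)‖ ^ 2 - lsLoss X Y W₀)
      = (sigmaStar X * ‖X * (W - W₀)‖) ^ 2 := by ring
    _ ≤ ‖Xᵀ * (X * (W - W₀))‖ ^ 2 := by
        have := sigmaStar_nonneg X
        gcongr
        exact sigmaStar_mul_norm_mul_le _ _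

end LeastSquares

theorem add_sq_mul_norm_sq_le [DecidableEq q] [DecidableEq r] {a : Matrix p q ℝ}
    {b : Matrix q r ℝ} (hpq : Fintype.card p ≤ Fintype.card q)
    (hrq : Fintype.card r ≤ Fintype.card q) (G : Matrix p r ℝ) :
    (sigmaMin a ^ 2 + sigmaMin b ^ 2) * ‖G‖ ^ 2 ≤ ‖G * bᵀ‖ ^ 2 + ‖aᵀ * G‖ ^ 2 := by
  have ha := sigmaMin_nonneg a
  have hb := sigmaMin_nonneg b
  have h_left : sigmaMin a * ‖G‖ ≤ ‖aᵀ * G‖ := sigmaMin_mul_norm_le_norm_transpose_mul hpq G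
  have h_right : sigmaMin b * ‖G‖ ≤ ‖G * bᵀ‖ := sigmaMin_mul_norm_le_norm_mul_transpose hrq G
  calc (sigmaMin a ^ 2 + sigmaMin b ^ 2) * ‖G‖ ^ 2
      = (sigmaMin b * ‖G‖) ^ 2 + (sigmaMin a * ‖G‖) ^ 2 := by ring
    _ ≤ _ := by gcongr

theorem joint_pl_lsLoss_mul {s : Type*} [Fintype s] [DecidableEq q] [DecidableEq r] [DecidableEq s]
    (X : Matrix p q ℝ) (Y : Matrix p r ℝ) {a : Matrix q s ℝ} {b : Matrix s r ℝ}
    (hqs : Fintype.card q ≤ Fintype.card s) (hrs : Fintype.card r ≤ Fintype.card s) :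
    2 * ((sigmaMin a ^ 2 + sigmaMin b ^ 2) * sigmaStar X ^ 2) *
        (lsLoss X Y (a * b) - lsMin X Y) ≤
      ‖lsGrad X Y (a * b) * bᵀ‖ ^ 2 + ‖aᵀ * lsGrad X Y (a * b)‖ ^ 2 :=
  calc _ = (sigmaMin a ^ 2 + sigmaMin b ^ 2) *
        (2 * sigmaStar X ^ 2 * (lsLoss X Y (a * b) - lsMin X Y)) := by ring
    _ ≤ (sigmaMin a ^ 2 + sigmaMin b ^ 2) * ‖lsGrad X Y (a * b)‖ ^ 2 := by
        gcongr
        exact le_norm_lsGrad_sq X Y _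
    _ ≤ _ := add_sq_mul_norm_sq_le hqs hrs _

section Step

variable (G : Matrix p r ℝ) (a : Matrix p q ℝ) (b : Matrix q r ℝ) (δ : Matrix p q ℝ)

/-- The first-order change of the product `a b` when the factors move along `G bᵀ + δ` and
`aᵀ G`: the partial gradients belonging to a gradient `G` at `a b`, the first one with error
`δ`. -/
def firstVariation : Matrix p r ℝ :=
  (G * bᵀ + δ) * b + a * (aᵀ * G)

/-- The second-order change of the product `a b` when the factors move along `G bᵀ + δ` and
`aᵀ G`. -/
def secondVariation : Matrix p r ℝ :=
  (G * bᵀ + δ) * (aᵀ * G)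

/-- The squared norm of both partial gradients and of the error `δ`, the quantity in which all
error terms of a descent step are measured. -/
noncomputable def stepEnergy : ℝ :=
  ‖G * bᵀ‖ ^ 2 + ‖aᵀ * G‖ ^ 2 + ‖δ‖ ^ 2

theorem sub_smul_mul_sub_smul (α : ℝ) :
    (a - α • (G * bᵀ + δ)) * (b - α • (aᵀ * G)) =
      a * b + (α ^ 2 • secondVariation G a b δ - α • firstVariation G a b δ) := by
  rw [secondVariation, firstVariation]
  generalize G * bᵀ + δ = P
  generalize aᵀ * G = Q
  simp only [Matrix.sub_mul, Matrix.mul_sub, Matrix.smul_mul, Matrix.mul_smul, smul_add,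
    smul_sub, smul_smul, sq]
  abel

theorem inner_firstVariation :
    inner ℝ G (firstVariation G a b δ) = ‖G * bᵀ‖ ^ 2 + inner ℝ (G * bᵀ) δ + ‖aᵀ * G‖ ^ 2 := by
  rw [firstVariation, inner_add_right, inner_mul_right_eq_inner_mul_transpose,
    inner_mul_right_eq_inner_transpose_mul, inner_add_right, real_inner_self_eq_norm_sq,
    real_inner_self_eq_norm_sq]

theorem stepEnergy_nonneg : 0 ≤ stepEnergy G a b δ := by
  unfold stepEnergy
  positivity

theorem norm_add_sq_add_norm_sq_le_stepEnergy :
    ‖G * bᵀ + δ‖ ^ 2 + ‖aᵀ * G‖ ^ 2 ≤ 2 * stepEnergy G a b δ := by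
  rw [stepEnergy]
  linarith [parallelogram_law_with_norm ℝ (G * bᵀ) δ, sq_nonneg ‖G * bᵀ - δ‖,
    sq_nonneg ‖aᵀ * G‖]

theorem norm_add_mul_norm_le_stepEnergy :
    ‖G * bᵀ + δ‖ * ‖aᵀ * G‖ ≤ stepEnergy G a b δ := by
  linarith [norm_add_sq_add_norm_sq_le_stepEnergy G a b δ,
    two_mul_le_add_sq ‖G * bᵀ + δ‖ ‖aᵀ * G‖]

theorem norm_secondVariation_le_stepEnergy : ‖secondVariation G a b δ‖ ≤ stepEnergy G a b δ :=
  (frobenius_norm_mul _ _).trans (norm_add_mul_norm_le_stepEnergy G a b δ)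

theorem norm_firstVariation_le [DecidableEq q] [DecidableEq r] :
    ‖firstVariation G a b δ‖ ≤ sigmaMax b * ‖G * bᵀ + δ‖ + sigmaMax a * ‖aᵀ * G‖ :=
  (norm_add_le _ _).trans
    (add_le_add (norm_mul_le_sigmaMax_mul_right _ b) (norm_mul_le_sigmaMax_mul a _))

theorem norm_firstVariation_sq_le [DecidableEq q] [DecidableEq r] :
    ‖firstVariation G a b δ‖ ^ 2 ≤
      2 * (sigmaMax a ^ 2 + sigmaMax b ^ 2) * stepEnergy G a b δ :=
  calc ‖firstVariation G a b δ‖ ^ 2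
      ≤ (sigmaMax b * ‖G * bᵀ + δ‖ + sigmaMax a * ‖aᵀ * G‖) ^ 2 := by
        gcongr
        exact norm_firstVariation_le G a b δ
    _ ≤ (sigmaMax a ^ 2 + sigmaMax b ^ 2) * (‖G * bᵀ + δ‖ ^ 2 + ‖aᵀ * G‖ ^ 2) := by
        linarith [sq_nonneg (sigmaMax b * ‖aᵀ * G‖ - sigmaMax a * ‖G * bᵀ + δ‖)]
    _ ≤ (sigmaMax a ^ 2 + sigmaMax b ^ 2) * (2 * stepEnergy G a b δ) := by
        gcongr
        exact norm_add_sq_add_norm_sq_le_stepEnergy G a b δ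
    _ = _ := by ring

theorem norm_secondVariation_le [DecidableEq r] :
    ‖secondVariation G a b δ‖ ≤ sigmaMax b * ‖G‖ * ‖aᵀ * G‖ + ‖δ‖ * ‖aᵀ * G‖ := by
  have h_mul : ‖G * bᵀ * (aᵀ * G)‖ ≤ sigmaMax b * ‖G‖ * ‖aᵀ * G‖ :=
    calc ‖G * bᵀ * (aᵀ * G)‖ = ‖G * (bᵀ * (aᵀ * G))‖ := by rw [Matrix.mul_assoc]
      _ ≤ ‖G‖ * (sigmaMax b * ‖aᵀ * G‖) :=
        (frobenius_norm_mul _ _).trans (by gcongr; exact norm_transpose_mul_le_sigmaMax_mul b _)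
      _ = _ := by ring
  rw [secondVariation, Matrix.add_mul]
  exact (norm_add_le _ _).trans (add_le_add h_mul (frobenius_norm_mul _ _))

theorem norm_secondVariation_le_sigmaMax_mul [DecidableEq q] [DecidableEq r] :
    ‖secondVariation G a b δ‖ ≤ sigmaMax (a * b) * ‖G‖ ^ 2 + ‖δ‖ * (sigmaMax a * ‖G‖) := by
  have h_mul : ‖G * bᵀ * (aᵀ * G)‖ ≤ sigmaMax (a * b) * ‖G‖ ^ 2 :=
    calc ‖G * bᵀ * (aᵀ * G)‖ = ‖G * ((a * b)ᵀ * G)‖ := by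
          simp only [transpose_mul, Matrix.mul_assoc]
      _ ≤ ‖G‖ * (sigmaMax (a * b) * ‖G‖) :=
        (frobenius_norm_mul _ _).trans
          (by gcongr; exact norm_transpose_mul_le_sigmaMax_mul (a * b) G)
      _ = _ := by ring
  rw [secondVariation, Matrix.add_mul]
  refine (norm_add_le _ _).trans (add_le_add h_mul ((frobenius_norm_mul _ _).trans ?_))
  gcongr
  exact norm_transpose_mul_le_sigmaMax_mul a G

theorem norm_secondVariation_sq_le [DecidableEq q] [DecidableEq r] :
    ‖secondVariation G a b δ‖ ^ 2 ≤
      (sigmaMax (a * b) * ‖G‖ ^ 2 + ‖δ‖ * (sigmaMax a * ‖G‖)) * stepEnergy G a b δ := by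
  rw [sq]
  exact mul_le_mul (norm_secondVariation_le_sigmaMax_mul G a b δ)
    (norm_secondVariation_le_stepEnergy G a b δ) (norm_nonneg _)
    ((norm_nonneg _).trans (norm_secondVariation_le_sigmaMax_mul G a b δ))

theorem norm_firstVariation_mul_norm_secondVariation_le [DecidableEq q] [DecidableEq r] :
    ‖firstVariation G a b δ‖ * ‖secondVariation G a b δ‖ ≤
      (‖δ‖ * sigmaMax b + 3 / 2 * (sigmaMax a ^ 2 + sigmaMax b ^ 2) * ‖G‖) *
        stepEnergy G a b δ := by
  have hU := norm_firstVariation_le G a b δ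
  have hE := norm_secondVariation_le G a b δ
  have hPB := norm_add_mul_norm_le_stepEnergy G a b δ
  have hB : ‖aᵀ * G‖ ≤ sigmaMax a * ‖G‖ := norm_transpose_mul_le_sigmaMax_mul a G
  have hBB : ‖aᵀ * G‖ ^ 2 ≤ stepEnergy G a b δ := by
    rw [stepEnergy]
    linarith [sq_nonneg ‖G * bᵀ‖, sq_nonneg ‖δ‖]
  have hδB : ‖δ‖ * ‖aᵀ * G‖ ≤ 1 / 2 * stepEnergy G a b δ := by
    rw [stepEnergy]
    linarith [two_mul_le_add_sq ‖δ‖ ‖aᵀ * G‖, sq_nonneg ‖G * bᵀ‖]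
  have hx := sigmaMax_nonneg b
  have hy := sigmaMax_nonneg a
  set x := sigmaMax b
  set y := sigmaMax a
  set S := stepEnergy G a b δ
  calc _ ≤ (x * ‖G * bᵀ + δ‖ + y * ‖aᵀ * G‖) * (x * ‖G‖ * ‖aᵀ * G‖ + ‖δ‖ * ‖aᵀ * G‖) := by
        gcongr
    _ = x * (x * ‖G‖ + ‖δ‖) * (‖G * bᵀ + δ‖ * ‖aᵀ * G‖) + x * y * ‖G‖ * ‖aᵀ * G‖ ^ 2 +
        y * ‖aᵀ * G‖ * (‖δ‖ * ‖aᵀ * G‖) := by ring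
    _ ≤ x * (x * ‖G‖ + ‖δ‖) * S + x * y * ‖G‖ * S + y * (y * ‖G‖) * (1 / 2 * S) := by gcongr
    _ ≤ _ := by
        have hS : 0 ≤ ‖G‖ * S := mul_nonneg (norm_nonneg G) (stepEnergy_nonneg G a b δ)
        nlinarith [two_mul_le_add_sq x y, mul_nonneg hS (sq_nonneg (x - y)),
          mul_nonneg hS (sq_nonneg y)]

theorem inner_sub_smul_le {α : ℝ} (hα : 0 ≤ α) :
    inner ℝ G (α ^ 2 • secondVariation G a b δ - α • firstVariation G a b δ) ≤
      α ^ 2 * ‖G‖ * stepEnergy G a b δ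
        - α / 2 * (‖G * bᵀ‖ ^ 2 + ‖aᵀ * G‖ ^ 2) + α / 2 * ‖δ‖ ^ 2 := by
  have h_second : inner ℝ G (secondVariation G a b δ) ≤ ‖G‖ * stepEnergy G a b δ :=
    (real_inner_le_norm _ _).trans
      (by gcongr; exact norm_secondVariation_le_stepEnergy G a b δ)
  have h_error : 1 / 2 * (‖G * bᵀ‖ ^ 2 + ‖aᵀ * G‖ ^ 2) - 1 / 2 * ‖δ‖ ^ 2 ≤
      inner ℝ G (firstVariation G a b δ) := by
    rw [inner_firstVariation]
    linarith [norm_add_sq_real (G * bᵀ) δ, sq_nonneg ‖G * bᵀ + δ‖, sq_nonneg ‖aᵀ * G‖]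
  rw [inner_sub_right, real_inner_smul_right, real_inner_smul_right]
  linarith [mul_le_mul_of_nonneg_left h_second (sq_nonneg α),
    mul_le_mul_of_nonneg_left h_error hα]

/-- The constant bounding the quadratic error of a descent step with step size `α`, an error of
norm `d` in the gradient of the first factor, and a gradient of norm at most `ρ` at `a b`. The
coefficients `3` are those of `Data.smoothConst`. -/
noncomputable def stepConst [DecidableEq q] [DecidableEq r] (α d ρ : ℝ) : ℝ :=
  sigmaMax a ^ 2 + sigmaMax b ^ 2 + 3 * α * d * sigmaMax b
    + 3 * α * (sigmaMax a ^ 2 + sigmaMax b ^ 2) * ρ + 3 * α ^ 2 * d * sigmaMax a * ρ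
    + 3 * α ^ 2 * sigmaMax (a * b) * ρ ^ 2

theorem norm_sub_smul_sq_le [DecidableEq q] [DecidableEq r] {α ρ : ℝ} (hα : 0 ≤ α)
    (hρ : ‖G‖ ≤ ρ) :
    1 / 2 * ‖α ^ 2 • secondVariation G a b δ - α • firstVariation G a b δ‖ ^ 2 ≤
      α ^ 2 * stepConst a b α ‖δ‖ ρ * stepEnergy G a b δ := by
  have hU := norm_firstVariation_sq_le G a b δ
  have hUE := norm_firstVariation_mul_norm_secondVariation_le G a b δ
  have hE := norm_secondVariation_sq_le G a b δ
  have hx := sigmaMax_nonneg b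
  have hy := sigmaMax_nonneg a
  have hz := sigmaMax_nonneg (a * b)
  have hS := stepEnergy_nonneg G a b δ
  rw [stepConst]
  set U := firstVariation G a b δ
  set E := secondVariation G a b δ
  set x := sigmaMax b
  set y := sigmaMax a
  set z := sigmaMax (a * b)
  set S := stepEnergy G a b δ
  calc 1 / 2 * ‖α ^ 2 • E - α • U‖ ^ 2 ≤ 1 / 2 * (α ^ 2 * ‖E‖ + α * ‖U‖) ^ 2 := by
        gcongr
        refine (norm_sub_le _ _).trans_eq ?_
        rw [norm_smul_of_nonneg (sq_nonneg α), norm_smul_of_nonneg hα]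
    _ = α ^ 2 * (1 / 2 * ‖U‖ ^ 2 + α * (‖U‖ * ‖E‖) + α ^ 2 / 2 * ‖E‖ ^ 2) := by ring
    _ ≤ α ^ 2 * (1 / 2 * (2 * (y ^ 2 + x ^ 2) * S)
          + α * ((‖δ‖ * x + 3 / 2 * (y ^ 2 + x ^ 2) * ‖G‖) * S)
          + α ^ 2 / 2 * ((z * ‖G‖ ^ 2 + ‖δ‖ * (y * ‖G‖)) * S)) := by gcongr
    _ ≤ α ^ 2 * (1 / 2 * (2 * (y ^ 2 + x ^ 2) * S)
          + α * ((3 * ‖δ‖ * x + 3 * (y ^ 2 + x ^ 2) * ρ) * S)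
          + α ^ 2 / 2 * ((6 * z * ρ ^ 2 + 6 * ‖δ‖ * (y * ρ)) * S)) := by
        gcongr <;> linarith [norm_nonneg δ]
    _ = α ^ 2 * (y ^ 2 + x ^ 2 + 3 * α * ‖δ‖ * x + 3 * α * (y ^ 2 + x ^ 2) * ρ
          + 3 * α ^ 2 * ‖δ‖ * y * ρ + 3 * α ^ 2 * z * ρ ^ 2) * S := by ring

end Step

theorem lsLoss_step_le {s : Type*} [Fintype s] [DecidableEq q] [DecidableEq r] [DecidableEq s]
    (X : Matrix p q ℝ) (Y : Matrix p r ℝ) {a : Matrix q s ℝ} {b : Matrix s r ℝ}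
    {G : Matrix q r ℝ} (hG : lsGrad X Y (a * b) = G) (δ : Matrix q s ℝ) {α ρ : ℝ} (hα : 0 ≤ α)
    (hρ : ‖G‖ ≤ ρ) :
    lsLoss X Y ((a - α • (G * bᵀ + δ)) * (b - α • (aᵀ * G))) ≤
      lsLoss X Y (a * b)
        - (α / 2 - α ^ 2 * (sigmaMax X ^ 2 * stepConst a b α ‖δ‖ ρ + ρ)) *
          (‖G * bᵀ‖ ^ 2 + ‖aᵀ * G‖ ^ 2)
        + (α / 2 + α ^ 2 * (sigmaMax X ^ 2 * stepConst a b α ‖δ‖ ρ + ρ)) * ‖δ‖ ^ 2 := by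
  rw [sub_smul_mul_sub_smul, lsLoss_add, hG]
  set S := stepEnergy G a b δ with hS
  set V := α ^ 2 • secondVariation G a b δ - α • firstVariation G a b δ
  have h_inner : inner ℝ G V ≤
      α ^ 2 * ρ * S - α / 2 * (‖G * bᵀ‖ ^ 2 + ‖aᵀ * G‖ ^ 2) + α / 2 * ‖δ‖ ^ 2 :=
    (inner_sub_smul_le G a b δ hα).trans (by gcongr; exact stepEnergy_nonneg G a b δ)
  have h_square : 1 / 2 * ‖X * V‖ ^ 2 ≤
      sigmaMax X ^ 2 * (α ^ 2 * stepConst a b α ‖δ‖ ρ * S) :=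
    calc 1 / 2 * ‖X * V‖ ^ 2 ≤ 1 / 2 * (sigmaMax X * ‖V‖) ^ 2 := by
          gcongr
          exact norm_mul_le_sigmaMax_mul X V
      _ = sigmaMax X ^ 2 * (1 / 2 * ‖V‖ ^ 2) := by ring
      _ ≤ _ :=
        mul_le_mul_of_nonneg_left (norm_sub_smul_sq_le G a b δ hα hρ) (sq_nonneg _)
  rw [hS, stepEnergy] at h_inner h_square
  linarith

end Frobenius

namespace Data

variable {N N' m n h : ℕ} (D : Data N N' m n)

/-- The concatenated label matrix `[Y_val; √γ Y_trn]` belonging to `Xpen`. -/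
noncomputable def Ypen (γ : ℝ) : Matrix (Fin N' ⊕ Fin N) (Fin n) ℝ :=
  fromRows D.Yval (√γ • D.Ytrn)

theorem Xpen_mul_sub_Ypen (γ : ℝ) (W : Matrix (Fin m) (Fin n) ℝ) :
    D.Xpen γ * W - D.Ypen γ =
      fromRows (D.Xval * W - D.Yval) (√γ • (D.Xtrn * W - D.Ytrn)) := by
  rw [Ypen, Xpen, fromRows_mul, Matrix.smul_mul, smul_sub]
  ext (i | i) j <;> rfl

theorem lsLoss_Xpen_Ypen {γ : ℝ} (hγ : 0 ≤ γ) (W : Matrix (Fin m) (Fin n) ℝ) :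
    lsLoss (D.Xpen γ) (D.Ypen γ) W =
      lsLoss D.Xval D.Yval W + γ * lsLoss D.Xtrn D.Ytrn W := by
  have h_norm_sq : ‖D.Xpen γ * W - D.Ypen γ‖ ^ 2 =
      ‖D.Xval * W - D.Yval‖ ^ 2 + ‖√γ • (D.Xtrn * W - D.Ytrn)‖ ^ 2 := by
    rw [Xpen_mul_sub_Ypen]
    simp only [frobenius_norm_sq, Fintype.sum_sum_type, fromRows_apply_inl, fromRows_apply_inr]
  simp only [lsLoss, norm_sub_rev (D.Ypen γ), norm_sub_rev D.Yval, norm_sub_rev D.Ytrn]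
  rw [h_norm_sq, norm_smul, mul_pow, Real.norm_eq_abs, sq_abs, Real.sq_sqrt hγ]
  ring

theorem lsGrad_Xpen_Ypen {γ : ℝ} (hγ : 0 ≤ γ) (W : Matrix (Fin m) (Fin n) ℝ) :
    lsGrad (D.Xpen γ) (D.Ypen γ) W =
      lsGrad D.Xval D.Yval W + γ • lsGrad D.Xtrn D.Ytrn W := by
  rw [lsGrad, Xpen_mul_sub_Ypen, Xpen, transpose_fromRows, fromCols_mul_fromRows,
    transpose_smul, Matrix.smul_mul, Matrix.mul_smul, smul_smul, Real.mul_self_sqrt hγ]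
  rfl

theorem Ltrn_eq_lsLoss (W₁ : Matrix (Fin m) (Fin h) ℝ) (W₂ : Matrix (Fin h) (Fin n) ℝ) :
    D.Ltrn W₁ W₂ = lsLoss D.Xtrn D.Ytrn (W₁ * W₂) := by
  rw [Ltrn, lsLoss, Matrix.mul_assoc]

theorem Lval_eq_lsLoss (W₁ : Matrix (Fin m) (Fin h) ℝ) (W₂ : Matrix (Fin h) (Fin n) ℝ) :
    D.Lval W₁ W₂ = lsLoss D.Xval D.Yval (W₁ * W₂) := by
  rw [Lval, lsLoss, Matrix.mul_assoc]

theorem lsMin_le_Ltrn (W₁ : Matrix (Fin m) (Fin h) ℝ) (W₂ : Matrix (Fin h) (Fin n) ℝ) :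
    lsMin D.Xtrn D.Ytrn ≤ D.Ltrn W₁ W₂ := by
  rw [Ltrn_eq_lsLoss]
  exact lsMin_le_lsLoss _ _ _

theorem lsMin_le_LtrnStar (W₁ : Matrix (Fin m) (Fin h) ℝ) :
    lsMin D.Xtrn D.Ytrn ≤ D.LtrnStar W₁ :=
  le_ciInf (D.lsMin_le_Ltrn W₁)

theorem LtrnStar_le_Ltrn (W₁ : Matrix (Fin m) (Fin h) ℝ) (W₂ : Matrix (Fin h) (Fin n) ℝ) :
    D.LtrnStar W₁ ≤ D.Ltrn W₁ W₂ :=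
  ciInf_le ⟨_, Set.forall_mem_range.2 (D.lsMin_le_Ltrn W₁)⟩ W₂

theorem Lpen_eq_lsLoss_sub {γ : ℝ} (hγ : 0 ≤ γ) (W₁ : Matrix (Fin m) (Fin h) ℝ)
    (W₂ : Matrix (Fin h) (Fin n) ℝ) :
    D.Lpen γ W₁ W₂ = lsLoss (D.Xpen γ) (D.Ypen γ) (W₁ * W₂) - γ * D.LtrnStar W₁ := by
  rw [Lpen, Lval_eq_lsLoss, Ltrn_eq_lsLoss, lsLoss_Xpen_Ypen D hγ]
  ring

theorem Lpen_le_lsLoss_sub {γ : ℝ} (hγ : 0 ≤ γ) (W₁ : Matrix (Fin m) (Fin h) ℝ)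
    (W₂ : Matrix (Fin h) (Fin n) ℝ) :
    D.Lpen γ W₁ W₂ ≤
      lsLoss (D.Xpen γ) (D.Ypen γ) (W₁ * W₂) - γ * lsMin D.Xtrn D.Ytrn := by
  rw [Lpen_eq_lsLoss_sub D hγ]
  gcongr
  exact D.lsMin_le_LtrnStar W₁

theorem matGrad_Lval_add_smul_right {γ : ℝ} (hγ : 0 ≤ γ) (W₁ : Matrix (Fin m) (Fin h) ℝ)
    (W₂ : Matrix (Fin h) (Fin n) ℝ) :
    matGrad (fun V => D.Lval W₁ V) W₂ + γ • matGrad (fun V => D.Ltrn W₁ V) W₂ =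
      W₁ᵀ * lsGrad (D.Xpen γ) (D.Ypen γ) (W₁ * W₂) := by
  rw [D.lsGrad_Xpen_Ypen hγ, Matrix.mul_add, Matrix.mul_smul]
  simp only [Lval_eq_lsLoss, Ltrn_eq_lsLoss, matGrad_lsLoss_mul_right]

section RightInvertible

variable {W₁ : Matrix (Fin m) (Fin h) ℝ} {C : Matrix (Fin h) (Fin m) ℝ} (hC : W₁ * C = 1)
include hC

theorem LtrnStar_eq_lsMin : D.LtrnStar W₁ = lsMin D.Xtrn D.Ytrn := by
  rw [← lsMin_eq_iInf_mul_left _ _ hC]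
  simp only [LtrnStar, Ltrn_eq_lsLoss]

theorem LtrnStar_eventuallyEq_lsMin :
    (fun V : Matrix (Fin m) (Fin h) ℝ => D.LtrnStar V) =ᶠ[𝓝 W₁]
      fun _ => lsMin D.Xtrn D.Ytrn :=
  (eventually_exists_mul_eq_one hC).mono fun _ ⟨_, hV⟩ => D.LtrnStar_eq_lsMin hV

theorem differentiableAt_LtrnStar :
    DifferentiableAt ℝ (fun V : Matrix (Fin m) (Fin h) ℝ => D.LtrnStar V) W₁ :=
  (differentiableAt_const _).congr_of_eventuallyEq (D.LtrnStar_eventuallyEq_lsMin hC)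

theorem matGrad_LtrnStar : matGrad (fun V => D.LtrnStar V) W₁ = 0 :=
  (matGrad_congr (D.LtrnStar_eventuallyEq_lsMin hC)).trans (matGrad_const _ _)

theorem iInf_Ltrn_le_lsMin :
    ⨅ V : Matrix (Fin m) (Fin h) ℝ × Matrix (Fin h) (Fin n) ℝ, D.Ltrn V.1 V.2 ≤
      lsMin D.Xtrn D.Ytrn := by
  rw [← D.LtrnStar_eq_lsMin hC]
  exact le_ciInf fun W₂ => ciInf_le (f := fun V : Matrix (Fin m) (Fin h) ℝ ×
    Matrix (Fin h) (Fin n) ℝ => D.Ltrn V.1 V.2)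
    ⟨_, Set.forall_mem_range.2 fun V => D.lsMin_le_Ltrn V.1 V.2⟩ (W₁, W₂)

variable {γ : ℝ} (hγ : 0 ≤ γ)
include hγ

theorem Lpen_eq_lsLoss_sub_lsMin (W₂ : Matrix (Fin h) (Fin n) ℝ) :
    D.Lpen γ W₁ W₂ =
      lsLoss (D.Xpen γ) (D.Ypen γ) (W₁ * W₂) - γ * lsMin D.Xtrn D.Ytrn := by
  rw [D.Lpen_eq_lsLoss_sub hγ, D.LtrnStar_eq_lsMin hC]

theorem differentiableAt_Lpen (W₂ : Matrix (Fin h) (Fin n) ℝ) :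
    DifferentiableAt ℝ (fun W : Matrix (Fin m) (Fin h) ℝ × Matrix (Fin h) (Fin n) ℝ =>
      D.Lpen γ W.1 W.2) (W₁, W₂) := by
  refine DifferentiableAt.congr_of_eventuallyEq
    ((differentiable_lsLoss_mul (D.Xpen γ) (D.Ypen γ) (W₁, W₂)).sub_const
      (γ * lsMin D.Xtrn D.Ytrn)) ?_
  filter_upwards [continuous_fst.continuousAt.eventually (eventually_exists_mul_eq_one hC)]
    with W ⟨_, hW⟩
  exact D.Lpen_eq_lsLoss_sub_lsMin hW hγ W.2

theorem matGrad_Lpen_left (W₂ : Matrix (Fin h) (Fin n) ℝ) :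
    matGrad (fun V => D.Lpen γ V W₂) W₁ =
      lsGrad (D.Xpen γ) (D.Ypen γ) (W₁ * W₂) * W₂ᵀ := by
  rw [← matGrad_lsLoss_mul_left]
  refine (matGrad_congr ?_).trans (matGrad_sub_const _ (γ * lsMin D.Xtrn D.Ytrn) _)
  exact (eventually_exists_mul_eq_one hC).mono
    fun _ ⟨_, hV⟩ => D.Lpen_eq_lsLoss_sub_lsMin hV hγ W₂

theorem matGrad_Lpen_right (W₂ : Matrix (Fin h) (Fin n) ℝ) :
    matGrad (fun V => D.Lpen γ W₁ V) W₂ =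
      W₁ᵀ * lsGrad (D.Xpen γ) (D.Ypen γ) (W₁ * W₂) := by
  simp only [D.Lpen_eq_lsLoss_sub_lsMin hC hγ, matGrad_sub_const, matGrad_lsLoss_mul_right]

theorem normSqGradLpen_eq (W₂ : Matrix (Fin h) (Fin n) ℝ) :
    D.normSqGradLpen γ W₁ W₂ =
      ‖lsGrad (D.Xpen γ) (D.Ypen γ) (W₁ * W₂) * W₂ᵀ‖ ^ 2 +
        ‖W₁ᵀ * lsGrad (D.Xpen γ) (D.Ypen γ) (W₁ * W₂)‖ ^ 2 := by
  rw [normSqGradLpen, D.matGrad_Lpen_left hC hγ, D.matGrad_Lpen_right hC hγ]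

theorem matGrad_Lval_add_smul_sub_left (W₂ W₃ : Matrix (Fin h) (Fin n) ℝ) :
    matGrad (fun V => D.Lval V W₂) W₁ +
        γ • (matGrad (fun V => D.Ltrn V W₂) W₁ - matGrad (fun V => D.Ltrn V W₃) W₁) =
      lsGrad (D.Xpen γ) (D.Ypen γ) (W₁ * W₂) * W₂ᵀ + D.gradBias γ W₁ W₃ := by
  rw [gradBias, D.matGrad_LtrnStar hC, D.lsGrad_Xpen_Ypen hγ, Matrix.add_mul, Matrix.smul_mul]
  simp only [Lval_eq_lsLoss, Ltrn_eq_lsLoss, matGrad_lsLoss_mul_left]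
  module

variable (hcomp : D.Compatible h)
include hcomp

-- Applied with `ε₂` equal to the training suboptimality of `(V₁, V₂)`, compatibility yields weights
-- with smaller validation loss whose training loss exceeds the joint minimum by at most `ε₂`.
theorem lsMin_sub_le_Lpen (V₁ : Matrix (Fin m) (Fin h) ℝ) (V₂ : Matrix (Fin h) (Fin n) ℝ) :
    lsMin (D.Xpen γ) (D.Ypen γ) - γ * lsMin D.Xtrn D.Ytrn ≤ D.Lpen γ V₁ V₂ := by
  obtain ⟨U₁, U₂, ⟨-, h_optimal⟩, h_joint⟩ := hcomp 0 (D.Ltrn V₁ V₂ - D.LtrnStar V₁) le_rfl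
    (sub_nonneg.2 (D.LtrnStar_le_Ltrn V₁ V₂))
  have h_val : D.Lval U₁ U₂ ≤ D.Lval V₁ V₂ := by simpa using h_optimal V₁ V₂ le_rfl
  have h_trn : D.Ltrn U₁ U₂ - lsMin D.Xtrn D.Ytrn ≤ D.Ltrn V₁ V₂ - D.LtrnStar V₁ := by
    linarith [D.iInf_Ltrn_le_lsMin hC]
  calc lsMin (D.Xpen γ) (D.Ypen γ) - γ * lsMin D.Xtrn D.Ytrn
      ≤ lsLoss (D.Xpen γ) (D.Ypen γ) (U₁ * U₂) - γ * lsMin D.Xtrn D.Ytrn := by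
        gcongr
        exact lsMin_le_lsLoss _ _ _
    _ = D.Lval U₁ U₂ + γ * (D.Ltrn U₁ U₂ - lsMin D.Xtrn D.Ytrn) := by
        rw [lsLoss_Xpen_Ypen D hγ, Lval_eq_lsLoss, Ltrn_eq_lsLoss]
        ring
    _ ≤ D.Lpen γ V₁ V₂ := by
        unfold Lpen
        gcongr

theorem isLeast_lsMin_sub :
    IsLeast (Set.range fun W : Matrix (Fin m) (Fin h) ℝ × Matrix (Fin h) (Fin n) ℝ =>
      D.Lpen γ W.1 W.2) (lsMin (D.Xpen γ) (D.Ypen γ) - γ * lsMin D.Xtrn D.Ytrn) := by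
  obtain ⟨W₀, hW₀⟩ := exists_lsGrad_eq_zero (D.Xpen γ) (D.Ypen γ)
  refine ⟨⟨(W₁, C * W₀), ?_⟩,
    Set.forall_mem_range.2 fun V => D.lsMin_sub_le_Lpen hC hγ hcomp V.1 V.2⟩
  dsimp only
  rw [D.Lpen_eq_lsLoss_sub_lsMin hC hγ, ← Matrix.mul_assoc, hC, Matrix.one_mul,
    lsMin_eq_of_lsGrad_eq_zero hW₀]

theorem LpenStar_eq_lsMin_sub :
    D.LpenStar h γ = lsMin (D.Xpen γ) (D.Ypen γ) - γ * lsMin D.Xtrn D.Ytrn :=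
  (D.isLeast_lsMin_sub hC hγ hcomp).csInf_eq

theorem isLeast_LpenStar :
    IsLeast (Set.range fun W : Matrix (Fin m) (Fin h) ℝ × Matrix (Fin h) (Fin n) ℝ =>
      D.Lpen γ W.1 W.2) (D.LpenStar h γ) := by
  rw [D.LpenStar_eq_lsMin_sub hC hγ hcomp]
  exact D.isLeast_lsMin_sub hC hγ hcomp

theorem Lpen_sub_LpenStar (W₂ : Matrix (Fin h) (Fin n) ℝ) :
    D.Lpen γ W₁ W₂ - D.LpenStar h γ =
      lsLoss (D.Xpen γ) (D.Ypen γ) (W₁ * W₂) - lsMin (D.Xpen γ) (D.Ypen γ) := by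
  rw [D.Lpen_eq_lsLoss_sub_lsMin hC hγ, D.LpenStar_eq_lsMin_sub hC hγ hcomp,
    sub_sub_sub_cancel_right]

theorem joint_pl_Lpen (hmh : m ≤ h) (hnh : n ≤ h) (W₂ : Matrix (Fin h) (Fin n) ℝ) :
    D.normSqGradLpen γ W₁ W₂ ≥
      2 * D.plConst γ W₁ W₂ * (D.Lpen γ W₁ W₂ - D.LpenStar h γ) := by
  rw [D.normSqGradLpen_eq hC hγ, D.Lpen_sub_LpenStar hC hγ hcomp]
  exact joint_pl_lsLoss_mul _ _ (by simpa using hmh) (by simpa using hnh)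

theorem norm_lsGrad_le_sqrt (W₂ : Matrix (Fin h) (Fin n) ℝ) :
    ‖lsGrad (D.Xpen γ) (D.Ypen γ) (W₁ * W₂)‖ ≤
      √(2 * sigmaMax (D.Xpen γ) ^ 2 * (D.Lpen γ W₁ W₂ - D.LpenStar h γ)) := by
  rw [D.Lpen_sub_LpenStar hC hγ hcomp]
  exact Real.le_sqrt_of_sq_le (norm_lsGrad_sq_le _ _ _)

theorem smoothConst_eq (α d : ℝ) (W₂ : Matrix (Fin h) (Fin n) ℝ) :
    D.smoothConst γ α d W₁ W₂ =
      sigmaMax (D.Xpen γ) ^ 2 * stepConst W₁ W₂ α d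
          (√(2 * sigmaMax (D.Xpen γ) ^ 2 * (D.Lpen γ W₁ W₂ - D.LpenStar h γ)))
        + √(2 * sigmaMax (D.Xpen γ) ^ 2 * (D.Lpen γ W₁ W₂ - D.LpenStar h γ)) := by
  have h_gap : 0 ≤ D.Lpen γ W₁ W₂ - D.LpenStar h γ :=
    sub_nonneg.2 ((D.isLeast_LpenStar hC hγ hcomp).2 ⟨(W₁, W₂), rfl⟩)
  rw [smoothConst, stepConst, Real.sq_sqrt (by positivity)]
  ring

theorem Lpen_step_le {α : ℝ} (hα : 0 ≤ α) (W₂ : Matrix (Fin h) (Fin n) ℝ)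
    (δ : Matrix (Fin m) (Fin h) ℝ) :
    D.Lpen γ (W₁ - α • (lsGrad (D.Xpen γ) (D.Ypen γ) (W₁ * W₂) * W₂ᵀ + δ))
        (W₂ - α • (W₁ᵀ * lsGrad (D.Xpen γ) (D.Ypen γ) (W₁ * W₂))) ≤
      D.Lpen γ W₁ W₂
        - (α / 2 - α ^ 2 * D.smoothConst γ α ‖δ‖ W₁ W₂) * D.normSqGradLpen γ W₁ W₂
        + (α / 2 + α ^ 2 * D.smoothConst γ α ‖δ‖ W₁ W₂) * ‖δ‖ ^ 2 := by
  have h_step := lsLoss_step_le (D.Xpen γ) (D.Ypen γ) (a := W₁) (b := W₂) rfl δ hα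
    (D.norm_lsGrad_le_sqrt hC hγ hcomp W₂)
  rw [← D.smoothConst_eq hC hγ hcomp, ← D.normSqGradLpen_eq hC hγ] at h_step
  refine (D.Lpen_le_lsLoss_sub hγ _ _).trans ?_
  rw [D.Lpen_eq_lsLoss_sub_lsMin hC hγ]
  linarith

end RightInvertible

end Data

end BilevelRep

theorem lemma1_general {N N' m n h : ℕ} (D : BilevelRep.Data N N' m n) (hmh : m ≤ h)
    (hnh : n ≤ h) (hcomp : D.Compatible h) {γ α : ℝ} (hγ : 0 ≤ γ) (hα : 0 ≤ α)
    {W₁ W₁' : Matrix (Fin m) (Fin h) ℝ} {W₂ W₂' W₃ : Matrix (Fin h) (Fin n) ℝ}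
    (hstep₁ : W₁' = W₁ - α • (BilevelRep.matGrad (fun V => D.Lval V W₂) W₁ +
      γ • (BilevelRep.matGrad (fun V => D.Ltrn V W₂) W₁ -
        BilevelRep.matGrad (fun V => D.Ltrn V W₃) W₁)))
    (hstep₂ : W₂' = W₂ - α • (BilevelRep.matGrad (fun V => D.Lval W₁ V) W₂ +
      γ • BilevelRep.matGrad (fun V => D.Ltrn W₁ V) W₂))
    (hW₁ : BilevelRep.sigmaMin W₁ ≠ 0) :
    IsLeast (Set.range fun W : Matrix (Fin m) (Fin h) ℝ × Matrix (Fin h) (Fin n) ℝ =>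
      D.Lpen γ W.1 W.2) (D.LpenStar h γ) ∧
    DifferentiableAt ℝ (fun W : Matrix (Fin m) (Fin h) ℝ × Matrix (Fin h) (Fin n) ℝ =>
      D.Lpen γ W.1 W.2) (W₁, W₂) ∧
    DifferentiableAt ℝ (fun V : Matrix (Fin m) (Fin h) ℝ => D.LtrnStar V) W₁ ∧
    D.normSqGradLpen γ W₁ W₂ ≥
      2 * D.plConst γ W₁ W₂ * (D.Lpen γ W₁ W₂ - D.LpenStar h γ) ∧
    D.Lpen γ W₁' W₂' ≤
      D.Lpen γ W₁ W₂
        - (α / 2 - α ^ 2 * D.smoothConst γ α ‖D.gradBias γ W₁ W₃‖ W₁ W₂)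
          * D.normSqGradLpen γ W₁ W₂
        + (α / 2 + α ^ 2 * D.smoothConst γ α ‖D.gradBias γ W₁ W₃‖ W₁ W₂)
          * ‖D.gradBias γ W₁ W₃‖ ^ 2 := by
  obtain ⟨C, hC⟩ := BilevelRep.exists_mul_eq_one_of_sigmaMin_ne_zero (by simpa using hmh) hW₁
  refine ⟨D.isLeast_LpenStar hC hγ hcomp, D.differentiableAt_Lpen hC hγ W₂,
    D.differentiableAt_LtrnStar hC, D.joint_pl_Lpen hC hγ hcomp hmh hnh W₂, ?_⟩
  rw [hstep₁, hstep₂, D.matGrad_Lval_add_smul_sub_left hC hγ,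
    D.matGrad_Lval_add_smul_right hγ]
  exact D.Lpen_step_le hC hγ hcomp hα W₂ (D.gradBias γ W₁ W₃)

theorem lemma1 {N N' m n h : ℕ} (D : BilevelRep.Data N N' m n)
    (hNm : N ≤ m) (hN'm : N' ≤ m) (hmh : m ≤ h) (hnh : n ≤ h)
    (hXtrn : D.Xtrn.rank = N) (hXval : D.Xval.rank = N')
    (hcomp : D.Compatible h)
    (γ : ℝ) (hγ : 0 < γ) (α β : ℝ) (hα : 0 < α) (T : ℕ → ℕ)
    (W₁ : ℕ → Matrix (Fin m) (Fin h) ℝ) (W₂ W₃ : ℕ → Matrix (Fin h) (Fin n) ℝ)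
    (hPBGD : D.IsPBGD γ α β T W₁ W₂ W₃)
    (k : ℕ)
    (hW₁ : 0 < BilevelRep.sigmaMin (W₁ k) ^ 2) (hW₂ : 0 < BilevelRep.sigmaMin (W₂ k) ^ 2) :
    -- the minimum of the penalized objective exists
    IsLeast (Set.range fun W : Matrix (Fin m) (Fin h) ℝ × Matrix (Fin h) (Fin n) ℝ =>
      D.Lpen γ W.1 W.2) (D.LpenStar h γ) ∧
    -- the gradients below are those of differentiable functions
    DifferentiableAt ℝ (fun W : Matrix (Fin m) (Fin h) ℝ × Matrix (Fin h) (Fin n) ℝ =>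
      D.Lpen γ W.1 W.2) (W₁ k, W₂ k) ∧
    DifferentiableAt ℝ (fun V : Matrix (Fin m) (Fin h) ℝ => D.LtrnStar V) (W₁ k) ∧
    -- joint PL inequality
    D.normSqGradLpen γ (W₁ k) (W₂ k) ≥
      2 * D.plConst γ (W₁ k) (W₂ k) * (D.Lpen γ (W₁ k) (W₂ k) - D.LpenStar h γ) ∧
    -- descent inequality
    D.Lpen γ (W₁ (k + 1)) (W₂ (k + 1)) ≤
      D.Lpen γ (W₁ k) (W₂ k)
        - (α / 2 - α ^ 2 * D.smoothConst γ α ‖D.gradBias γ (W₁ k) (W₃ (k + 1))‖ (W₁ k) (W₂ k))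
          * D.normSqGradLpen γ (W₁ k) (W₂ k)
        + (α / 2 + α ^ 2 * D.smoothConst γ α ‖D.gradBias γ (W₁ k) (W₃ (k + 1))‖ (W₁ k) (W₂ k))
          * ‖D.gradBias γ (W₁ k) (W₃ (k + 1))‖ ^ 2 :=
  lemma1_general D hmh hnh hcomp hγ.le hα.le (hPBGD k).2.1 (hPBGD k).2.2 (sq_pos_iff.1 hW₁)
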